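/- Let $p\in(1,\infty)$, let $d\in\mathbb N_0$, and let $X=\mathbb R^d$ carry the Euclidean norm $\|\cdot\|$. Let $\mu$ be a Borel probability measure on $X$ with $\int_X\|y\|^p\,\mu(dy)<\infty$, and let $\phi\colon[0,\infty)\to[0,\infty]$ be nondecreasing with $\phi(0)=0$. For $h>0$ and $v\ge 0$ put $\phi_h(v)=h\,\phi(v/h)$. Let $\mathrm{Lip}_p$ be the set of all $f\colon X\to\mathbb R$ for which there is a constant $L\ge 0$ with $$|f(x_1)-f(x_2)|\le L\,\bigl(1+\max\{\|x_1\|,\|x_2\|\}\bigr)^{p-1}\|x_1-x_2\|\quad\text{for all }x_1,x_2\in X.$$ For $\Theta\subseteq L_p(\mu;X)$, $h>0$ and $f\in\mathrm{Lip}_p$ define $$\mathcal I_\Theta(h)f=\sup_{\theta\in\Theta}\Bigl(\int_X f(z)\,\mu_\theta(dz)-\phi_h\bigl(\|\theta\|_{L_p(\mu;X)}\bigr)\Bigr)\in[-\infty,\infty],$$ where $\mu_\theta$ is the law of $y\mapsto y+\theta(y)$ under $\mu$. Let $m\ge 1$ be an integer and let $\psi\colon\mathbb R\to\mathbb R$ be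 bounded, nonconstant and Lipschitz continuous. For $n\in\mathbb N_0$ let $\mathfrak N_d^{m,n}$ be the set of neural networks of depth $m$ and width $n$ with activation function $\psi$, that is, of all maps $$A_m\circ\psi\circ A_{m-1}\circ\cdots\circ\psi\circ A_0\colon\ \mathbb R^d\to\mathbb R^d,$$ where $A_0\colon\mathbb R^d\to\mathbb R^n$, $A_1,\dots,A_{m-1}\colon\mathbb R^n\to\mathbb R^n$ and $A_m\colon\mathbb R^n\to\mathbb R^d$ are affine, and $\psi$ is applied componentwise. Then $\mathfrak N_d^{m,n}\subseteq L_p(\mu;X)$ for all $n$ (each network being identified with its $\mu$-equivalence class) and, for all $h>0$ and all $f\in\mathrm{Lip}_p$, the sequence $\bigl(\mathcal I_{\mathfrak N_d^{m,n}}(h)f\bigr)_{n}$ is nondecreasing and $$\lim_{n\to\infty}\mathcal I_{\mathfrak N_d^{m,n}}(h)f=\mathcal I_{L_p(\mu;X)}(h)f\quad\text{in }[-\infty,\infty].$$ -/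

import Mathlib

open MeasureTheory Filter Topology Set
open scoped ENNReal NNReal Matrix

namespace ParametricRisk

/-- `μ` has a finite moment of order `p`; for a probability measure `μ` this says `μ ∈ 𝒫_p(X)`. -/
def HasFiniteMoment {X : Type*} [NormedAddCommGroup X] [MeasurableSpace X]
    (p : ℝ) (μ : Measure X) : Prop :=
  ∫⁻ y, ‖y‖ₑ ^ p ∂μ < ∞

/-- A penalty function `φ : [0, ∞) → [0, ∞]`: nondecreasing with `φ 0 = 0`. -/
structure IsPenalty (φ : ℝ≥0 → ℝ≥0∞) : Prop where
  monotone : Monotone φ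
  map_zero : φ 0 = 0

/-- The rescaled penalty `φ_h(v) = h φ(v / h)`, for `h > 0`. -/
noncomputable def scaledPenalty (φ : ℝ≥0 → ℝ≥0∞) (h : ℝ≥0) (v : ℝ≥0) : ℝ≥0∞ :=
  (h : ℝ≥0∞) * φ (v / h)

/-- The space `Lip_p` of locally Lipschitz functions with growth of order `p - 1` of the
Lipschitz constant. -/
def LipP {X : Type*} [NormedAddCommGroup X] (p : ℝ) : Set (X → ℝ) :=
  {f | ∃ L : ℝ, 0 ≤ L ∧ ∀ x₁ x₂ : X,
    |f x₁ - f x₂| ≤ L * (1 + max ‖x₁‖ ‖x₂‖) ^ (p - 1) * ‖x₁ - x₂‖}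

/-- The law `μ_θ` of `y + θ(y)` under `μ`. -/
noncomputable def shiftedLaw {X : Type*} [NormedAddCommGroup X] [MeasurableSpace X]
    (μ : Measure X) (θ : X → X) : Measure X :=
  μ.map (fun y => y + θ y)

/-- The parametric functional
`I_Θ(h) f = sup_{θ ∈ Θ} (∫ f dμ_θ - φ_h(‖θ‖_{L_p(μ; X)}))` with values in `[-∞, ∞]`, for a
parameter set `Θ ⊆ L_p(μ; X)`. -/
noncomputable def paramFunctional {X : Type*} [NormedAddCommGroup X] [MeasurableSpace X]
    (p : ℝ) (μ : Measure X) (φ : ℝ≥0 → ℝ≥0∞) (Θ : Set (Lp X (ENNReal.ofReal p) μ))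
    (h : ℝ≥0) (f : X → ℝ) : EReal :=
  ⨆ θ ∈ Θ, (((∫ z, f z ∂(shiftedLaw μ θ) : ℝ) : EReal) -
    ((scaledPenalty φ h ‖θ‖₊ : ℝ≥0∞) : EReal))

/-- The parameter set in `L_p(μ; X)` of the `μ`-equivalence classes of the maps in `S`. -/
def toParam {X : Type*} [NormedAddCommGroup X] [MeasurableSpace X]
    (p : ℝ) (μ : Measure X) (S : Set (X → X)) : Set (Lp X (ENNReal.ofReal p) μ) :=
  {θ | ∃ g ∈ S, θ =ᵐ[μ] g}

/-- Fully connected networks `ℝ^d → ℝ^k` in coordinates, with `n` neurons in each hidden layer.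
At depth `0` they are the affine maps `x ↦ M x + b`; at depth `m + 1` they are the maps
`A ∘ ψ ∘ g`, with `A : ℝ^n → ℝ^k` affine, `ψ` applied componentwise, and `g : ℝ^d → ℝ^n` a
network of depth `m`. -/
def networkMaps (ψ : ℝ → ℝ) (d n : ℕ) : ℕ → (k : ℕ) → Set ((Fin d → ℝ) → (Fin k → ℝ))
  | 0, k => {F | ∃ (M : Matrix (Fin k) (Fin d) ℝ) (b : Fin k → ℝ), F = fun x => M *ᵥ x + b}
  | m + 1, k => {F | ∃ g ∈ networkMaps ψ d n m n,
      ∃ (M : Matrix (Fin k) (Fin n) ℝ) (b : Fin k → ℝ),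
        F = fun x => M *ᵥ (fun i => ψ (g x i)) + b}

/-- The set `𝔑_d^{m,n}(ψ)` of networks of depth `m` and width `n` with activation function `ψ`,
as maps of the Euclidean space `ℝ^d` to itself. -/
def neuralNetworks (ψ : ℝ → ℝ) (d m n : ℕ) :
    Set (EuclideanSpace ℝ (Fin d) → EuclideanSpace ℝ (Fin d)) :=
  {g | ∃ F ∈ networkMaps ψ d n m d, g = fun x => WithLp.toLp 2 (F (WithLp.ofLp x))}

end ParametricRisk

/-! Widening a network is harmless, so the functionals increase with the width, and their limit is
the supremum over the union of all widths. This union is a linear subspace of `L_p`. It remains to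
show that it is dense and that density suffices.

Density suffices although `φ` may be discontinuous or infinite. The map `θ ↦ ∫ f dμ_θ` is continuous
by Hölder (`LipP.continuous_integral_shiftedLaw`). A point `θ ≠ 0` is a limit of networks in the
open ball of radius `‖θ‖`, whose penalties are no larger because `φ` is monotone; `θ = 0` is itself
a network (`paramFunctional_univ_le_of_dense`).

Density is proved by induction on the depth. If depth `m` approximates affine functions, then depth
`m + 1` approximates the ridge functions `ψ(⟪a, x⟫ + b)`, as `ψ` is Lipschitz. By Hahn-Banach these
span a dense subspace once an integrable `g` with `∫ ψ(⟪a, x⟫ + b) g dμ = 0` for all `a, b` must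
vanish (`AnnihilatesRidges.ae_eq_zero`). A Fourier argument gives this for integrable profiles. A
bounded `ψ` is made integrable by averaging twice over dilations and taking a second difference: the
result decays like `t⁻²`, is still annihilated, and is nonzero for some step because `ψ` is not
constant. -/

namespace ParametricRisk

/-! ### Algebra of networks: parallel composition, sums, padding, boundedness. -/

section Networks

variable {ψ : ℝ → ℝ} {d : ℕ}

theorem fromBlocks_mulVec_append {a b k l : ℕ} (M : Matrix (Fin k) (Fin a) ℝ)
    (N : Matrix (Fin l) (Fin b) ℝ) (u : Fin a → ℝ) (v : Fin b → ℝ) :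
    Matrix.reindex finSumFinEquiv finSumFinEquiv (Matrix.fromBlocks M 0 0 N) *ᵥ Fin.append u v =
      Fin.append (M *ᵥ u) (N *ᵥ v) := by
  ext i
  refine Fin.addCases (fun i => ?_) (fun i => ?_) i <;>
    simp [Matrix.mulVec, dotProduct, Fin.sum_univ_add]

theorem append_add_append {k l : ℕ} (u u' : Fin k → ℝ) (v v' : Fin l → ℝ) :
    Fin.append u v + Fin.append u' v' = Fin.append (u + u') (v + v') := by
  ext i
  refine Fin.addCases (fun i => ?_) (fun i => ?_) i <;> simp

theorem append_comp {k l : ℕ} (ψ : ℝ → ℝ) (u : Fin k → ℝ) (v : Fin l → ℝ) :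
    (fun i => ψ (Fin.append u v i)) = Fin.append (fun i => ψ (u i)) (fun i => ψ (v i)) := by
  ext i
  refine Fin.addCases (fun i => ?_) (fun i => ?_) i <;> simp

/-- Two networks of the same depth run in parallel. -/
theorem networkMaps_append {n₁ n₂ m : ℕ} : ∀ {k l : ℕ} {F : (Fin d → ℝ) → Fin k → ℝ}
    {G : (Fin d → ℝ) → Fin l → ℝ}, F ∈ networkMaps ψ d n₁ m k → G ∈ networkMaps ψ d n₂ m l →
      (fun x => Fin.append (F x) (G x)) ∈ networkMaps ψ d (n₁ + n₂) m (k + l) := by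
  induction m with
  | zero =>
    rintro k l F G ⟨M, b, rfl⟩ ⟨N, c, rfl⟩
    refine ⟨Matrix.of (Fin.append (m := k) (n := l) (fun i => M i) (fun i => N i)),
      Fin.append b c, ?_⟩
    ext x i
    refine Fin.addCases (fun i => ?_) (fun i => ?_) i <;>
      simp [Matrix.mulVec, dotProduct, Fin.append_left, Fin.append_right, -Fin.natAdd_eq_addNat]
  | succ m ih =>
    rintro k l F G ⟨f, hf, M, b, rfl⟩ ⟨g, hg, N, c, rfl⟩
    refine ⟨_, ih hf hg, Matrix.reindex finSumFinEquiv finSumFinEquiv (Matrix.fromBlocks M 0 0 N),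
      Fin.append b c, ?_⟩
    ext1 x
    rw [append_comp, fromBlocks_mulVec_append, append_add_append]

/-- The output layer is affine and absorbs a further affine map, so neither depth nor width changes.
-/
theorem networkMaps_affine {n m k l : ℕ} {F : (Fin d → ℝ) → Fin k → ℝ}
    (hF : F ∈ networkMaps ψ d n m k) (M : Matrix (Fin l) (Fin k) ℝ) (b : Fin l → ℝ) :
    (fun x => M *ᵥ F x + b) ∈ networkMaps ψ d n m l := by
  cases m with
  | zero =>
    obtain ⟨N, c, rfl⟩ := hF
    exact ⟨M * N, M *ᵥ c + b, by ext1 x; simp [Matrix.mulVec_add, add_assoc]⟩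
  | succ m =>
    obtain ⟨g, hg, N, c, rfl⟩ := hF
    exact ⟨g, hg, M * N, M *ᵥ c + b, by ext1 x; simp [Matrix.mulVec_add, add_assoc]⟩

theorem networkMaps_const (n m : ℕ) {k : ℕ} (c : Fin k → ℝ) :
    (fun _ => c) ∈ networkMaps ψ d n m k := by
  induction m generalizing k with
  | zero => exact ⟨0, c, by simp⟩
  | succ m ih => exact ⟨_, ih 0, 0, c, by simp⟩

theorem networkMaps_add {n₁ n₂ m k : ℕ} {F G : (Fin d → ℝ) → Fin k → ℝ}
    (hF : F ∈ networkMaps ψ d n₁ m k) (hG : G ∈ networkMaps ψ d n₂ m k) :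
    F + G ∈ networkMaps ψ d (n₁ + n₂) m k := by
  have h := networkMaps_affine (networkMaps_append hF hG)
    -- The block row `[1 | 1]` adds the two halves of the parallel network.
    (Matrix.of fun i => Fin.append ((1 : Matrix (Fin k) (Fin k) ℝ) i)
      ((1 : Matrix (Fin k) (Fin k) ℝ) i)) 0
  convert h using 1
  ext x i
  simp [Matrix.mulVec, dotProduct, Fin.sum_univ_add, Matrix.one_apply, -Fin.natAdd_eq_addNat]

theorem networkMaps_smul {n m k : ℕ} {F : (Fin d → ℝ) → Fin k → ℝ}
    (hF : F ∈ networkMaps ψ d n m k) (c : ℝ) : c • F ∈ networkMaps ψ d n m k := by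
  have h := networkMaps_affine hF (c • (1 : Matrix (Fin k) (Fin k) ℝ)) 0
  convert h using 1
  ext1 x
  simp [Matrix.smul_mulVec]

theorem networkMaps_mono_width {n n' : ℕ} (h : n ≤ n') (m k : ℕ) :
    networkMaps ψ d n m k ⊆ networkMaps ψ d n' m k := by
  intro F hF
  obtain ⟨r, rfl⟩ := Nat.exists_eq_add_of_le h
  exact add_zero F ▸ networkMaps_add hF (networkMaps_const r m (0 : Fin k → ℝ))

theorem neuralNetworks_mono {m : ℕ} : Monotone (neuralNetworks ψ d m) := by
  rintro n n' h g ⟨F, hF, rfl⟩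
  exact ⟨F, networkMaps_mono_width h m d hF, rfl⟩

theorem networkMaps_continuous (hψ : Continuous ψ) {n m : ℕ} : ∀ {k : ℕ}
    {F : (Fin d → ℝ) → Fin k → ℝ}, F ∈ networkMaps ψ d n m k → Continuous F := by
  induction m with
  | zero => rintro k F ⟨M, b, rfl⟩; fun_prop
  | succ m ih =>
    rintro k F ⟨g, hg, M, b, rfl⟩
    have := ih hg
    have h : Continuous fun x => (fun i => ψ (g x i)) := by fun_prop
    fun_prop

theorem networkMaps_bounded (hψ : ∃ C : ℝ, ∀ t, |ψ t| ≤ C) {n m k : ℕ}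
    {F : (Fin d → ℝ) → Fin k → ℝ} (hF : F ∈ networkMaps ψ d n (m + 1) k) :
    ∃ C : ℝ, ∀ x i, |F x i| ≤ C := by
  obtain ⟨g, hg, M, b, rfl⟩ := hF
  obtain ⟨C, hC⟩ := hψ
  refine ⟨∑ i, (∑ j, |M i j| * C + |b i|), fun x i => ?_⟩
  have hC0 : 0 ≤ C := (abs_nonneg _).trans (hC 0)
  refine le_trans ?_ (Finset.single_le_sum (f := fun i => ∑ j, |M i j| * C + |b i|)
    (fun i _ => by positivity) (Finset.mem_univ i))
  simp only [Pi.add_apply, Matrix.mulVec, dotProduct]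
  refine (abs_add_le _ _).trans (add_le_add_left ((Finset.abs_sum_le_sum_abs _ _).trans ?_) _)
  refine Finset.sum_le_sum fun j _ => ?_
  rw [abs_mul]
  exact mul_le_mul_of_nonneg_left (hC _) (abs_nonneg _)

theorem neuralNetworks_memLp {p : ℝ≥0∞} {μ : Measure (EuclideanSpace ℝ (Fin d))}
    [IsFiniteMeasure μ] (hψ : Continuous ψ) (hb : ∃ C : ℝ, ∀ t, |ψ t| ≤ C) {n m : ℕ}
    {g : EuclideanSpace ℝ (Fin d) → EuclideanSpace ℝ (Fin d)}
    (hg : g ∈ neuralNetworks ψ d (m + 1) n) : MemLp g p μ := by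
  obtain ⟨F, hF, rfl⟩ := hg
  obtain ⟨C, hC⟩ := networkMaps_bounded hb hF
  have hc : Continuous fun x : EuclideanSpace ℝ (Fin d) =>
      (WithLp.toLp 2 (F (WithLp.ofLp x)) : EuclideanSpace ℝ (Fin d)) := by
    have := networkMaps_continuous hψ hF
    fun_prop
  refine MemLp.of_bound hc.aestronglyMeasurable (√(∑ _i : Fin d, C ^ 2)) (ae_of_all _ fun x => ?_)
  rw [EuclideanSpace.norm_eq]
  refine Real.sqrt_le_sqrt (Finset.sum_le_sum fun i _ => ?_)
  exact pow_le_pow_left₀ (norm_nonneg _) (hC _ i) 2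

end Networks

/-! ### Functionals on `L_p` and a density criterion. -/

section Duality

variable {Ω : Type*} [MeasurableSpace Ω] {μ : Measure Ω} [IsFiniteMeasure μ] {p : ℝ≥0∞}

theorem sum_indicatorConstLp_biUnion {s : ℕ → Set Ω}
    (hs : ∀ i, MeasurableSet (s i)) (hd : Pairwise (Function.onFun Disjoint s)) (t : Finset ℕ) :
    ∑ i ∈ t, indicatorConstLp p (hs i) (measure_ne_top μ _) (1 : ℝ) =
      indicatorConstLp p (t.measurableSet_biUnion fun i _ => hs i) (measure_ne_top μ _) 1 := by
  classical
  induction t using Finset.induction_on with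
  | empty => simp
  | insert a t ha ih =>
    rw [Finset.sum_insert ha, ih, ← indicatorConstLp_disjoint_union]
    · congr 1
      simp
    · refine Set.disjoint_iUnion₂_right.2 fun i hi => hd ?_
      rintro rfl
      exact ha hi

theorem indicatorConstLp_eq_smul {s : Set Ω} (hs : MeasurableSet s) (c : ℝ) :
    indicatorConstLp p hs (measure_ne_top μ s) c =
      c • indicatorConstLp p hs (measure_ne_top μ s) (1 : ℝ) := by
  rw [indicatorConstLp, indicatorConstLp, ← MemLp.toLp_const_smul]
  congr 1
  ext x
  by_cases hx : x ∈ s <;> simp [hx]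

variable [Fact (1 ≤ p)]

/-- Finite partial unions exhaust the union in measure, which for `p ≠ ∞` means `L_p`-convergence of
indicators. This gives countable additivity of the set function below. -/
theorem hasSum_indicatorConstLp_iUnion (hp : p ≠ ∞) {s : ℕ → Set Ω}
    (hs : ∀ i, MeasurableSet (s i)) (hd : Pairwise (Function.onFun Disjoint s)) :
    HasSum (fun i => indicatorConstLp p (hs i) (measure_ne_top μ _) (1 : ℝ))
      (indicatorConstLp p (MeasurableSet.iUnion hs) (measure_ne_top μ _) 1) := by
  unfold HasSum
  simp only [SummationFilter.unconditional_filter]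
  simp_rw [sum_indicatorConstLp_biUnion hs hd]
  refine tendsto_indicatorConstLp_set hp ?_
  have hsub : ∀ t : Finset ℕ, (⋃ i ∈ t, s i) ⊆ ⋃ i, s i := fun t =>
    iUnion₂_subset fun i _ => subset_iUnion s i
  have h1 : ∀ t : Finset ℕ, μ (symmDiff (⋃ i ∈ t, s i) (⋃ i, s i)) =
      μ (⋃ i, s i) - μ (⋃ i ∈ t, s i) := fun t => by
    rw [symmDiff_of_le (hsub t), measure_sdiff (hsub t)
      (t.measurableSet_biUnion fun i _ => hs i).nullMeasurableSet (measure_ne_top _ _)]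
  simp_rw [h1]
  have h2 : Tendsto (fun t : Finset ℕ => μ (⋃ i ∈ t, s i)) atTop (𝓝 (μ (⋃ i, s i))) := by
    have h3 : (⋃ t : Finset ℕ, ⋃ i ∈ t, s i) = ⋃ i, s i := by
      refine subset_antisymm (iUnion_subset hsub) (iUnion_subset fun i => ?_)
      exact subset_iUnion_of_subset {i} (by simp)
    rw [← h3]
    exact tendsto_measure_iUnion_atTop fun t t' h => biUnion_subset_biUnion_left h
  have := ENNReal.Tendsto.sub (tendsto_const_nhds (x := μ (⋃ i, s i))) h2
    (Or.inl (measure_ne_top _ _))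
  simpa using this

/-- The set function induced on measurable sets by a functional on `L_p`. -/
noncomputable def dualSignedMeasure (hp : p ≠ ∞) (ℓ : Lp ℝ p μ →L[ℝ] ℝ) : SignedMeasure Ω := by
  classical
  exact
  { measureOf' := fun s => if hs : MeasurableSet s then
      ℓ (indicatorConstLp p hs (measure_ne_top μ s) 1) else 0
    empty' := by simp
    not_measurable' := fun s hs => dif_neg hs
    m_iUnion' := fun s hs hd => by
      simp only [hs, MeasurableSet.iUnion hs, dite_true]
      exact (hasSum_indicatorConstLp_iUnion hp hs hd).mapL ℓ }

theorem dualSignedMeasure_apply (hp : p ≠ ∞) (ℓ : Lp ℝ p μ →L[ℝ] ℝ) {s : Set Ω}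
    (hs : MeasurableSet s) :
    dualSignedMeasure hp ℓ s = ℓ (indicatorConstLp p hs (measure_ne_top μ s) 1) := by
  unfold dualSignedMeasure
  exact dif_pos hs

/-- Radon-Nikodym: null sets have zero indicator in `L_p`, so the set function is absolutely
continuous. An `L_1` density is enough here; its membership in the dual `L_q` is never used. -/
theorem exists_integrable_dual_indicator (hp : p ≠ ∞) (ℓ : Lp ℝ p μ →L[ℝ] ℝ) :
    ∃ g : Ω → ℝ, Integrable g μ ∧ ∀ {s : Set Ω} (hs : MeasurableSet s),
      ℓ (indicatorConstLp p hs (measure_ne_top μ s) 1) = ∫ x in s, g x ∂μ := by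
  have hac : dualSignedMeasure hp ℓ ≪ᵥ μ.toENNRealVectorMeasure := by
    refine VectorMeasure.AbsolutelyContinuous.mk fun s hs h0 => ?_
    rw [Measure.toENNRealVectorMeasure_apply_measurable hs] at h0
    rw [dualSignedMeasure_apply hp ℓ hs]
    have : indicatorConstLp p hs (measure_ne_top μ s) (1 : ℝ) = 0 := by
      rw [← indicatorConstLp_empty (p := p) (μ := μ) (c := (1 : ℝ)),
        indicatorConstLp_inj _ _ _ _ one_ne_zero]
      exact ae_eq_empty.2 h0
    rw [this, map_zero]
  refine ⟨(dualSignedMeasure hp ℓ).rnDeriv μ, SignedMeasure.integrable_rnDeriv _ _,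
    fun {s} hs => ?_⟩
  rw [← dualSignedMeasure_apply hp ℓ hs, ← withDensityᵥ_apply
    (SignedMeasure.integrable_rnDeriv _ _) hs, SignedMeasure.withDensityᵥ_rnDeriv_eq _ _ hac]

/-- On bounded functions, a functional on `L_p` of a finite measure is integration against an
integrable function. -/
theorem exists_integrable_dual (hp : p ≠ ∞) (ℓ : Lp ℝ p μ →L[ℝ] ℝ) :
    ∃ g : Ω → ℝ, Integrable g μ ∧
      (∀ {s : Set Ω} (hs : MeasurableSet s),
        ℓ (indicatorConstLp p hs (measure_ne_top μ s) 1) = ∫ x in s, g x ∂μ) ∧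
      ∀ {f : Ω → ℝ} (_ : Measurable f) (hf : MemLp f p μ) (C : ℝ), (∀ x, |f x| ≤ C) →
        ℓ (hf.toLp f) = ∫ x, f x * g x ∂μ := by
  obtain ⟨g, hg, hℓ⟩ := exists_integrable_dual_indicator hp ℓ
  refine ⟨g, hg, hℓ, fun {f} hfm hf C hC => ?_⟩
  have hsimple : ∀ (u : SimpleFunc Ω ℝ) (hu : MemLp u p μ),
      ℓ (hu.toLp u) = ∫ x, u x * g x ∂μ := by
    intro u
    have hi : ∀ v : SimpleFunc Ω ℝ, Integrable (fun x => v x * g x) μ := fun v => by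
      obtain ⟨D, hD⟩ := v.exists_forall_norm_le
      exact hg.bdd_mul v.aestronglyMeasurable (ae_of_all _ hD)
    induction u using SimpleFunc.induction with
    | const c hs =>
      rename_i s
      intro hu
      have h1 : hu.toLp _ = c • indicatorConstLp p hs (measure_ne_top μ s) (1 : ℝ) := by
        rw [← indicatorConstLp_eq_smul, indicatorConstLp]
        congr 1
      rw [h1, map_smul, hℓ hs, smul_eq_mul, ← integral_const_mul, ← integral_indicator hs]
      congr 1
      ext x
      by_cases hx : x ∈ s <;> simp [hx]
    | add _ hu hv =>
      rename_i u v _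
      intro huv
      have h1 : MemLp u p μ := SimpleFunc.memLp_of_isFiniteMeasure u p μ
      have h2 : MemLp v p μ := SimpleFunc.memLp_of_isFiniteMeasure v p μ
      have : huv.toLp _ = h1.toLp u + h2.toLp v := by
        rw [← MemLp.toLp_add]; rfl
      rw [this, map_add, hu h1, hv h2, ← integral_add (hi u) (hi v)]
      simp [add_mul]
  have h1 := (ℓ.continuous.tendsto _).comp (SimpleFunc.tendsto_approxOn_range_Lp hp hfm hf)
  refine tendsto_nhds_unique h1 ?_
  simp only [Function.comp_def, hsimple]
  -- The simple approximants are bounded by twice `|f|`, hence `C + C`.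
  refine tendsto_integral_of_dominated_convergence (fun x => (C + C) * |g x|) (fun n =>
    (SimpleFunc.aestronglyMeasurable _).mul hg.1) (hg.abs.const_mul _) (fun n =>
    ae_of_all _ fun x => ?_) (ae_of_all _ fun x => ?_)
  · rw [norm_mul]
    refine mul_le_mul_of_nonneg_right ?_ (norm_nonneg _)
    exact (SimpleFunc.norm_approxOn_zero_le hfm (by simp) x n).trans (add_le_add (hC x) (hC x))
  · exact (SimpleFunc.tendsto_approxOn hfm (by simp) (subset_closure (by simp))).mul_const _

/-- A closed subspace of `L_p` is everything if it contains a set of bounded functions that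
determines integrable functions. -/
theorem eq_top_of_bounded_determining (hp : p ≠ ∞) (W : Submodule ℝ (Lp ℝ p μ))
    (hW : IsClosed (W : Set (Lp ℝ p μ))) (S : Set (Ω → ℝ))
    (hS : ∀ f ∈ S, Measurable f ∧ (∃ C : ℝ, ∀ x, |f x| ≤ C) ∧
      ∀ hf : MemLp f p μ, hf.toLp f ∈ W)
    (hdet : ∀ g : Ω → ℝ, Integrable g μ → (∀ f ∈ S, ∫ x, f x * g x ∂μ = 0) → g =ᵐ[μ] 0) :
    W = ⊤ := by
  by_contra hne
  obtain ⟨x, hx⟩ := SetLike.exists_not_mem_of_ne_top W hne rfl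
  obtain ⟨ℓ, hℓ, hℓW⟩ : ∃ ℓ : Lp ℝ p μ →L[ℝ] ℝ, ℓ x ≠ 0 ∧ ∀ w ∈ W, ℓ w = 0 := by
    obtain ⟨ℓ, u, hu, hux⟩ := geometric_hahn_banach_closed_point W.convex hW hx
    have h0 : 0 < u := by simpa using hu 0 W.zero_mem
    -- A functional bounded on a subspace vanishes there: otherwise scaling `w` attains the strict
    -- bound `u`.
    refine ⟨ℓ, (h0.trans hux).ne', fun w hw => ?_⟩
    by_contra hw0
    have := hu _ (W.smul_mem (u / ℓ w) hw)
    rw [map_smul, smul_eq_mul, div_mul_cancel₀ _ hw0] at this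
    exact this.false
  obtain ⟨g, hg, hind, hbd⟩ := exists_integrable_dual hp ℓ
  have hg0 : g =ᵐ[μ] 0 := by
    refine hdet g hg fun f hf => ?_
    obtain ⟨hm, ⟨C, hC⟩, hfW⟩ := hS f hf
    have hfp : MemLp f p μ := MemLp.of_bound hm.aestronglyMeasurable C (ae_of_all _ hC)
    rw [← hbd hm hfp C hC, hℓW _ (hfW hfp)]
  refine hℓ ?_
  have hℓ0 : ∀ y, ℓ y = 0 := by
    intro y
    refine Lp.induction hp (motive := fun y => ℓ y = 0) ?_ ?_ ?_ y
    · intro c s hs _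
      rw [Lp.simpleFunc.coe_indicatorConst, indicatorConstLp_eq_smul, map_smul, hind hs,
        setIntegral_congr_ae hs (hg0.mono fun x hx _ => hx)]
      simp
    · intro f g hf hg _ h1 h2
      rw [map_add, h1, h2, add_zero]
    · exact isClosed_eq ℓ.continuous continuous_const
  exact hℓ0 x

end Duality

/-! ### Dilation averages and decay of second differences. -/

section LogAverage

/-- The average of `f` over the dilations `exp u`, `u ∈ [0, 1]`. -/
noncomputable def logAvg (f : ℝ → ℝ) (t : ℝ) : ℝ := ∫ u in (0 : ℝ)..1, f (Real.exp u * t)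

/-- The symmetric second difference of `f` with step `η`. -/
def secondDiff (f : ℝ → ℝ) (η t : ℝ) : ℝ := f (t + η) + f (t - η) - 2 * f t

variable {f : ℝ → ℝ} {C : ℝ}

theorem continuous_logAvg (hf : Continuous f) : Continuous (logAvg f) :=
  intervalIntegral.continuous_parametric_intervalIntegral_of_continuous' (by fun_prop) _ _

theorem abs_logAvg_le (hC : ∀ t, |f t| ≤ C) (t : ℝ) : |logAvg f t| ≤ C := by
  have := intervalIntegral.norm_integral_le_of_norm_le_const (a := 0) (b := 1)
    (f := fun u => f (Real.exp u * t)) (C := C) fun u _ => hC _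
  simpa [logAvg] using this

theorem logAvg_neg (f : ℝ → ℝ) (t : ℝ) : logAvg (fun s => f (-s)) t = logAvg f (-t) := by
  simp [logAvg]

/-- With `v = u + log t` the average becomes the integral of `f ∘ exp` over the sliding window `[log
t, log t + 1]`, differentiable for merely continuous `f`. -/
theorem hasDerivAt_logAvg (hf : Continuous f) {t : ℝ} (ht : 0 < t) :
    HasDerivAt (logAvg f) ((f (Real.exp 1 * t) - f t) / t) t := by
  have hk : Continuous fun v => f (Real.exp v) := by fun_prop
  have hG : ∀ τ, HasDerivAt (fun τ => ∫ v in τ..(τ + 1), f (Real.exp v))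
      (f (Real.exp (τ + 1)) - f (Real.exp τ)) τ := by
    intro τ
    have h1 : ∀ x, HasDerivAt (fun τ => ∫ v in (0 : ℝ)..τ, f (Real.exp v)) (f (Real.exp x)) x :=
      fun x => hk.integral_hasStrictDerivAt 0 x |>.hasDerivAt
    have h2 : HasDerivAt (fun τ => ∫ v in (0 : ℝ)..(τ + 1), f (Real.exp v))
        (f (Real.exp (τ + 1))) τ := (h1 (τ + 1)).comp_add_const τ 1
    refine (h2.sub (h1 τ)).congr_of_eventuallyEq (.of_forall fun s => ?_)
    exact (intervalIntegral.integral_interval_sub_left (hk.intervalIntegrable _ _)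
      (hk.intervalIntegrable _ _)).symm
  have h := (hG (Real.log t)).comp t (Real.hasDerivAt_log ht.ne')
  rw [Real.exp_add, Real.exp_log ht, mul_comm t, ← div_eq_mul_inv] at h
  refine h.congr_of_eventuallyEq ?_
  filter_upwards [lt_mem_nhds ht] with s hs
  simp only [Function.comp_apply, logAvg]
  have := intervalIntegral.integral_comp_add_right (a := 0) (b := 1)
    (fun v => f (Real.exp v)) (Real.log s)
  rw [zero_add, add_comm 1] at this
  rw [← this]
  simp [Real.exp_add, Real.exp_log hs]

theorem hasDerivAt_deriv_logAvg_logAvg (hf : Continuous f) {t : ℝ} (ht : 0 < t) :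
    HasDerivAt (fun s => (logAvg f (Real.exp 1 * s) - logAvg f s) / s)
      ((((f (Real.exp 1 * (Real.exp 1 * t)) - f (Real.exp 1 * t)) / (Real.exp 1 * t) *
        Real.exp 1 - (f (Real.exp 1 * t) - f t) / t) * t -
        (logAvg f (Real.exp 1 * t) - logAvg f t) * 1) / t ^ 2) t := by
  have he : 0 < Real.exp 1 * t := by positivity
  have h1 : HasDerivAt (fun s => Real.exp 1 * s) (Real.exp 1) t := by
    simpa using (hasDerivAt_id t).const_mul (Real.exp 1)
  have h2 := (hasDerivAt_logAvg hf he).comp t h1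
  exact (h2.sub (hasDerivAt_logAvg hf ht)).div (hasDerivAt_id t) ht.ne'

/-- The numerator consists of three differences of functions bounded by `C`, whence `6 * C`. -/
theorem abs_deriv_deriv_logAvg_le (hC : ∀ t, |f t| ≤ C) {t : ℝ} (ht : 0 < t) :
    |((((f (Real.exp 1 * (Real.exp 1 * t)) - f (Real.exp 1 * t)) / (Real.exp 1 * t) *
        Real.exp 1 - (f (Real.exp 1 * t) - f t) / t) * t -
        (logAvg f (Real.exp 1 * t) - logAvg f t) * 1) / t ^ 2)| ≤ 6 * C / t ^ 2 := by
  have he : Real.exp 1 ≠ 0 := (Real.exp_pos 1).ne'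
  rw [abs_div, abs_of_pos (pow_pos ht 2)]
  refine div_le_div_of_nonneg_right ?_ (by positivity)
  have h1 : ((f (Real.exp 1 * (Real.exp 1 * t)) - f (Real.exp 1 * t)) / (Real.exp 1 * t) *
        Real.exp 1 - (f (Real.exp 1 * t) - f t) / t) * t -
        (logAvg f (Real.exp 1 * t) - logAvg f t) * 1 =
      (f (Real.exp 1 * (Real.exp 1 * t)) - f (Real.exp 1 * t)) - (f (Real.exp 1 * t) - f t) -
        (logAvg f (Real.exp 1 * t) - logAvg f t) := by
    field_simp
  rw [h1]
  have a1 := abs_le.1 (hC (Real.exp 1 * (Real.exp 1 * t)))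
  have a2 := abs_le.1 (hC (Real.exp 1 * t))
  have a3 := abs_le.1 (hC t)
  have a4 := abs_le.1 (abs_logAvg_le hC (Real.exp 1 * t))
  have a5 := abs_le.1 (abs_logAvg_le hC t)
  rw [abs_le]
  constructor <;> linarith

/-- The mean value inequality is applied twice. On `[t - η, t + η]` every point is at least `t / 2`,
which turns `6 * C` into `24 * C`. -/
theorem abs_secondDiff_logAvg_le_of_pos (hf : Continuous f) (hC : ∀ t, |f t| ≤ C) {η t : ℝ}
    (hη : 0 < η) (ht : 2 * η ≤ t) :
    |secondDiff (logAvg (logAvg f)) η t| ≤ 24 * C * η ^ 2 / t ^ 2 := by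
  have hC0 : 0 ≤ C := (abs_nonneg _).trans (hC 0)
  have hg := continuous_logAvg hf
  set D : ℝ → ℝ := fun s => (logAvg f (Real.exp 1 * s) - logAvg f s) / s with hD
  have hpos : 0 < t - η := by linarith
  have hD1 : ∀ s ∈ Icc (t - η) t, ‖D (s + η) - D s‖ ≤ 24 * C / t ^ 2 * η := by
    intro s hs
    have := (convex_Icc s (s + η)).norm_image_sub_le_of_norm_hasDerivWithin_le (f := D)
      (C := 24 * C / t ^ 2)
      (fun r hr => (hasDerivAt_deriv_logAvg_logAvg hf
        (hpos.trans_le (hs.1.trans hr.1))).hasDerivWithinAt)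
      (fun r hr => ?_) (left_mem_Icc.2 (by linarith)) (right_mem_Icc.2 (by linarith))
    · simpa [abs_of_pos hη] using this
    · have hr0 : t - η ≤ r := hs.1.trans hr.1
      refine (abs_deriv_deriv_logAvg_le hC (hpos.trans_le hr0)).trans ?_
      have : t / 2 ≤ r := by linarith
      have ht0 : 0 < t := by linarith
      calc 6 * C / r ^ 2 ≤ 6 * C / (t / 2) ^ 2 := by gcongr
        _ = 24 * C / t ^ 2 := by field_simp; ring
  have := (convex_Icc (t - η) t).norm_image_sub_le_of_norm_hasDerivWithin_le
    (f := fun s => logAvg (logAvg f) (s + η) - logAvg (logAvg f) s)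
    (f' := fun s => D (s + η) - D s) (C := 24 * C / t ^ 2 * η)
    (fun s hs => (((hasDerivAt_logAvg hg (by linarith [hs.1])).comp_add_const s η).sub
      (hasDerivAt_logAvg hg (by linarith [hs.1]))).hasDerivWithinAt)
    hD1 (left_mem_Icc.2 (by linarith)) (right_mem_Icc.2 (by linarith))
  rw [sub_add_cancel, sub_sub_cancel, Real.norm_eq_abs, Real.norm_eq_abs, abs_of_pos hη] at this
  convert this using 1
  · rw [secondDiff]; congr 1; ring
  · ring

theorem abs_secondDiff_logAvg_le (hf : Continuous f) (hC : ∀ t, |f t| ≤ C) {η t : ℝ}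
    (hη : 0 < η) (ht : 2 * η ≤ |t|) :
    |secondDiff (logAvg (logAvg f)) η t| ≤ 24 * C * η ^ 2 / t ^ 2 := by
  rcases le_total 0 t with h0 | h0
  · exact abs_secondDiff_logAvg_le_of_pos hf hC hη (by rwa [abs_of_nonneg h0] at ht)
  · rw [abs_of_nonpos h0] at ht
    have := abs_secondDiff_logAvg_le_of_pos (f := fun s => f (-s)) (by fun_prop)
      (fun s => hC _) hη ht
    have h1 : ∀ s, logAvg (logAvg fun s => f (-s)) s = logAvg (logAvg f) (-s) := fun s => by
      rw [← logAvg_neg, funext (logAvg_neg f)]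
    rw [neg_sq] at this
    convert this using 2
    simp only [secondDiff, h1]
    ring_nf

theorem continuous_secondDiff (hf : Continuous f) (η : ℝ) : Continuous (secondDiff f η) := by
  unfold secondDiff
  fun_prop

theorem abs_secondDiff_le (hC : ∀ t, |f t| ≤ C) (η t : ℝ) : |secondDiff f η t| ≤ 4 * C := by
  have a1 := abs_le.1 (hC (t + η))
  have a2 := abs_le.1 (hC (t - η))
  have a3 := abs_le.1 (hC t)
  rw [secondDiff, abs_le]
  constructor <;> linarith

theorem integrable_secondDiff_logAvg (hf : Continuous f) (hC : ∀ t, |f t| ≤ C) {η : ℝ}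
    (hη : 0 < η) : Integrable (secondDiff (logAvg (logAvg f)) η) := by
  have hC0 : 0 ≤ C := (abs_nonneg _).trans (hC 0)
  -- A generous constant: `4C + 24Cη²` suffices for `|t| ≥ 2η` and `4C + 16Cη²` for `|t| < 2η`.
  refine (integrable_inv_one_add_sq.const_mul (10 * C + 40 * C * η ^ 2)).mono'
    (continuous_secondDiff (continuous_logAvg (continuous_logAvg hf)) η).aestronglyMeasurable
    (ae_of_all _ fun t => ?_)
  rw [← div_eq_mul_inv, le_div_iff₀ (by positivity), Real.norm_eq_abs]
  rcases le_or_gt (2 * η) |t| with h | h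
  · have h1 := abs_secondDiff_logAvg_le hf hC hη h
    have ht : 0 < t ^ 2 := by
      rw [← sq_abs]; have : 0 < |t| := by linarith
      positivity
    have h4 : 4 * η ^ 2 ≤ t ^ 2 := by
      rw [← sq_abs t]; nlinarith
    rw [le_div_iff₀ ht] at h1
    have h5 : |secondDiff (logAvg (logAvg f)) η t| ≤ 4 * C :=
      abs_secondDiff_le (abs_logAvg_le (abs_logAvg_le hC)) η t
    nlinarith [mul_nonneg hC0 (sq_nonneg η)]
  · have h5 : |secondDiff (logAvg (logAvg f)) η t| ≤ 4 * C :=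
      abs_secondDiff_le (abs_logAvg_le (abs_logAvg_le hC)) η t
    have h4 : t ^ 2 ≤ 4 * η ^ 2 := by
      rw [← sq_abs t]; nlinarith [abs_nonneg t]
    nlinarith [mul_nonneg hC0 (sq_nonneg η), mul_nonneg hC0 (sq_nonneg t)]

/-- Dilation averages of nonconstant functions are nonconstant. -/
theorem eq_apply_zero_of_logAvg_const (hf : Continuous f) (h : ∀ t, logAvg f t = logAvg f 0)
    (t : ℝ) : f t = f 0 := by
  have key : ∀ {f : ℝ → ℝ}, Continuous f → (∀ t, logAvg f t = logAvg f 0) →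
      ∀ t, 0 < t → f t = f 0 := by
    intro f hf h t ht
    -- The vanishing derivative makes `f` invariant under dilation by `e`; contracting to `0` and
    -- continuity finish.
    have h1 : ∀ s, 0 < s → f (Real.exp 1 * s) = f s := by
      intro s hs
      have h2 := hasDerivAt_logAvg hf hs
      rw [funext h] at h2
      have := h2.unique (hasDerivAt_const s _)
      rw [div_eq_zero_iff, or_iff_left hs.ne'] at this
      linarith
    have h3 : ∀ n : ℕ, f (Real.exp (-1) ^ n * t) = f t := by
      intro n
      induction n with
      | zero => simp
      | succ n ih =>
        rw [← ih, ← h1 _ (by positivity), pow_succ]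
        congr 1
        have : Real.exp 1 * Real.exp (-1) = 1 := by rw [← Real.exp_add]; simp
        linear_combination (Real.exp (-1) ^ n * t) * this
    have h4 : Tendsto (fun n : ℕ => f (Real.exp (-1) ^ n * t)) atTop (𝓝 (f (0 * t))) :=
      (hf.tendsto _).comp ((tendsto_pow_atTop_nhds_zero_of_lt_one (Real.exp_pos _).le
        (by simp)).mul_const t)
    simp only [h3, zero_mul] at h4
    exact tendsto_nhds_unique tendsto_const_nhds h4
  rcases lt_trichotomy t 0 with h0 | rfl | h0
  · have := key (f := fun s => f (-s)) (by fun_prop)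
      (fun s => by rw [logAvg_neg, logAvg_neg, h, neg_zero]) (-t) (by linarith)
    simpa using this
  · rfl
  · exact key hf h t h0

/-- Bounded functions with vanishing second differences are constant. -/
theorem eq_of_secondDiff_eq_zero (hC : ∀ t, |f t| ≤ C)
    (h : ∀ η, 0 < η → ∀ t, secondDiff f η t = 0) (t : ℝ) : f t = f 0 := by
  have key : ∀ a b, a < b → f a = f b := by
    intro a b hab
    -- Along the progression of step `b - a` the function is affine, so boundedness forces slope
    -- zero. The recurrence has order two, hence two consecutive values.
    have h1 : ∀ n : ℕ, f (a + n * (b - a)) = f a + n * (f b - f a) ∧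
        f (a + (n + 1) * (b - a)) = f a + (n + 1) * (f b - f a) := by
      intro n
      induction n with
      | zero => simp
      | succ n ih =>
        have := h (b - a) (by linarith) (a + (n + 1) * (b - a))
        rw [secondDiff] at this
        have e1 : a + (n + 1) * (b - a) - (b - a) = a + n * (b - a) := by ring
        have e2 : a + (n + 1) * (b - a) + (b - a) = a + ((n + 1 : ℝ) + 1) * (b - a) := by ring
        rw [e1, e2, ih.1, ih.2] at this
        push_cast
        exact ⟨ih.2, by linarith⟩
    by_contra hne
    have hpos : 0 < |f b - f a| := abs_pos.2 (sub_ne_zero.2 (Ne.symm hne))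
    obtain ⟨n, hn⟩ := exists_nat_gt (2 * C / |f b - f a|)
    rw [div_lt_iff₀ hpos] at hn
    have h2 : (n : ℝ) * |f b - f a| = |f (a + n * (b - a)) - f a| := by
      rw [(h1 n).1, add_sub_cancel_left, abs_mul, Nat.abs_cast]
    have h3 := abs_sub (f (a + n * (b - a))) (f a)
    linarith [hC (a + n * (b - a)), hC a]
  rcases lt_trichotomy t 0 with h0 | rfl | h0
  · exact key _ _ h0
  · rfl
  · exact (key _ _ h0).symm

theorem exists_secondDiff_logAvg_ne_zero (hf : Continuous f) (hC : ∀ t, |f t| ≤ C)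
    (hne : ∃ s t, f s ≠ f t) : ∃ η, 0 < η ∧ ∃ t, secondDiff (logAvg (logAvg f)) η t ≠ 0 := by
  by_contra! h
  have h1 := eq_of_secondDiff_eq_zero (abs_logAvg_le (abs_logAvg_le hC)) h
  have h2 := eq_apply_zero_of_logAvg_const (continuous_logAvg hf) h1
  have h3 := eq_apply_zero_of_logAvg_const hf h2
  obtain ⟨s, t, hst⟩ := hne
  exact hst (by rw [h3 s, h3 t])

end LogAverage

/-! ### Annihilators of ridge functions vanish. -/

section Discriminatory

open scoped RealInnerProductSpace FourierTransform

variable {E : Type*} [NormedAddCommGroup E] [InnerProductSpace ℝ E] [MeasurableSpace E]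
  [BorelSpace E] [SecondCountableTopology E] {μ : Measure E}

/-- `g` annihilates all ridge functions with profile `f`. -/
def AnnihilatesRidges (μ : Measure E) (g : E → ℝ) (f : ℝ → ℝ) : Prop :=
  ∀ (a : E) (b : ℝ), ∫ x, f (⟪a, x⟫ + b) * g x ∂μ = 0

variable {g : E → ℝ} {f : ℝ → ℝ} {C : ℝ}

theorem integrable_ridge_mul (hg : Integrable g μ) (hf : Continuous f) (hC : ∀ t, |f t| ≤ C)
    (a : E) (b : ℝ) : Integrable (fun x => f (⟪a, x⟫ + b) * g x) μ :=
  hg.bdd_mul (c := C) (by fun_prop) (ae_of_all _ fun _ => hC _)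

/-- A dilated ridge is the ridge with parameters `exp u • a` and `exp u * b`; Fubini does the rest.
-/
theorem AnnihilatesRidges.logAvg [SFinite μ] (h : AnnihilatesRidges μ g f) (hg : Integrable g μ)
    (hf : Continuous f) (hC : ∀ t, |f t| ≤ C) : AnnihilatesRidges μ g (logAvg f) := by
  intro a b
  have h1 : ∀ x, ParametricRisk.logAvg f (⟪a, x⟫ + b) * g x =
      ∫ u in (0 : ℝ)..1, f (⟪Real.exp u • a, x⟫ + Real.exp u * b) * g x := by
    intro x
    rw [intervalIntegral.integral_mul_const, ParametricRisk.logAvg]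
    simp_rw [real_inner_smul_left, mul_add]
  simp_rw [h1, intervalIntegral.integral_of_le zero_le_one]
  rw [integral_integral_swap]
  · exact integral_eq_zero_of_ae (ae_of_all _ fun u => h _ _)
  · have : Integrable (fun z : E × ℝ => g z.1) (μ.prod (volume.restrict (Ioc (0 : ℝ) 1))) :=
      hg.comp_fst _
    exact this.bdd_mul (c := C) (by fun_prop) (ae_of_all _ fun _ => hC _)

theorem AnnihilatesRidges.secondDiff (h : AnnihilatesRidges μ g f) (hg : Integrable g μ)
    (hf : Continuous f) (hC : ∀ t, |f t| ≤ C) (η : ℝ) :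
    AnnihilatesRidges μ g (secondDiff f η) := by
  intro a b
  have h1 : ∀ x, ParametricRisk.secondDiff f η (⟪a, x⟫ + b) * g x =
      f (⟪a, x⟫ + (b + η)) * g x + f (⟪a, x⟫ + (b - η)) * g x - 2 * (f (⟪a, x⟫ + b) * g x) := by
    intro x
    rw [ParametricRisk.secondDiff, ← add_assoc, ← add_sub_assoc]
    ring
  have hi := integrable_ridge_mul hg hf hC a
  simp_rw [h1]
  rw [integral_sub, integral_add (hi _) (hi _), integral_const_mul, h, h, h]
  · simp
  · exact (hi _).add (hi _)
  · exact (hi _).const_mul _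

/-- Integrating the ridge identity in direction `ξ⁻¹ • v` against `exp(-i b ξ)` over `b` gives `J ξ`
times the desired integral. This needs `ξ ≠ 0` and `J ξ ≠ 0`; if there were no such `ξ`, Fourier
inversion would give `f = 0`. -/
theorem AnnihilatesRidges.integral_cexp_eq_zero [SFinite μ] (h : AnnihilatesRidges μ g f)
    (hg : Integrable g μ) (hf : Continuous f) (hfi : Integrable f) (hne : ∃ t, f t ≠ 0) (v : E) :
    ∫ x, Complex.exp (⟪x, v⟫ * Complex.I) * g x ∂μ = 0 := by
  set J : ℝ → ℂ := fun ξ => ∫ b : ℝ, Complex.exp (-(b * ξ) * Complex.I) * (f b : ℂ) with hJ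
  have hnorm : ∀ r : ℝ, ‖Complex.exp (-r * Complex.I)‖ = 1 := fun r => by
    rw [← Complex.ofReal_neg]; exact Complex.norm_exp_ofReal_mul_I _
  -- a nonzero frequency at which the Fourier transform does not vanish
  obtain ⟨ξ, hξ0, hξ⟩ : ∃ ξ : ℝ, ξ ≠ 0 ∧ J ξ ≠ 0 := by
    by_contra! hc
    have hF : ∀ w : ℝ, 𝓕 (fun b => (f b : ℂ)) w = J (2 * Real.pi * w) := by
      intro w
      rw [Real.fourier_eq']
      refine integral_congr_ae (μ := volume) (ae_of_all _ fun b => ?_)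
      simp only [smul_eq_mul]
      congr 2
      simp
      ring
    have hF0 : 𝓕 (fun b => (f b : ℂ)) =ᵐ[volume] 0 := by
      filter_upwards [compl_mem_ae_iff.2 (measure_singleton (μ := (volume : Measure ℝ)) 0)]
        with w hw
      rw [hF, Pi.zero_apply]
      exact hc _ (mul_ne_zero (by positivity) hw)
    have h2 := (show Continuous fun b => (f b : ℂ) by fun_prop).fourierInv_fourier_eq
      hfi.ofReal ((integrable_zero ℝ ℂ volume).congr hF0.symm)
    obtain ⟨t, ht⟩ := hne
    have h3 := congrFun h2 t
    rw [Real.fourierInv_eq'] at h3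
    rw [integral_congr_ae (g := 0) (hF0.mono fun w hw => by simp [hw])] at h3
    simp at h3
    exact ht (by exact_mod_cast h3.symm)
  have hfub : ∫ x, ∫ b : ℝ, Complex.exp (-(b * ξ) * Complex.I) *
      ((f (⟪ξ⁻¹ • v, x⟫ + b) * g x : ℝ) : ℂ) ∂volume ∂μ = 0 := by
    rw [integral_integral_swap]
    · refine integral_eq_zero_of_ae (ae_of_all _ fun b => ?_)
      simp only [integral_const_mul, integral_complex_ofReal, h (ξ⁻¹ • v) b]
      simp
    · have h1 : AEStronglyMeasurable (fun z : E × ℝ => f (⟪ξ⁻¹ • v, z.1⟫ + z.2) * g z.1)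
          (μ.prod volume) := by
        refine AEStronglyMeasurable.mul (Continuous.aestronglyMeasurable (by fun_prop)) ?_
        exact hg.1.comp_fst
      have h2 : Integrable (fun z : E × ℝ => f (⟪ξ⁻¹ • v, z.1⟫ + z.2) * g z.1)
          (μ.prod volume) := by
        rw [integrable_prod_iff h1]
        refine ⟨ae_of_all _ fun x => (hfi.comp_add_left ⟪ξ⁻¹ • v, x⟫).mul_const (g x), ?_⟩
        simp only [norm_mul, integral_mul_const]
        simp_rw [integral_add_left_eq_self (μ := (volume : Measure ℝ)) (fun b => ‖f b‖)]
        exact hg.norm.const_mul _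
      refine h2.ofReal.bdd_mul (c := 1) (by fun_prop) (ae_of_all _ fun z => ?_)
      rw [← Complex.ofReal_mul, hnorm]
  have hinner : ∀ x, ∫ b : ℝ, Complex.exp (-(b * ξ) * Complex.I) *
      ((f (⟪ξ⁻¹ • v, x⟫ + b) * g x : ℝ) : ℂ) =
      J ξ * (Complex.exp (⟪x, v⟫ * Complex.I) * g x) := by
    intro x
    have h1 := integral_add_left_eq_self (μ := (volume : Measure ℝ))
      (fun b : ℝ => Complex.exp (-(b * ξ) * Complex.I) * (f b : ℂ)) ⟪ξ⁻¹ • v, x⟫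
    rw [hJ]
    dsimp only
    rw [← h1, ← integral_mul_const]
    refine integral_congr_ae (ae_of_all _ fun b => ?_)
    simp only [Complex.ofReal_mul, Complex.ofReal_add]
    have h2 : Complex.exp (-((⟪ξ⁻¹ • v, x⟫ + b) * ξ) * Complex.I) *
        Complex.exp (⟪x, v⟫ * Complex.I) = Complex.exp (-(b * ξ) * Complex.I) := by
      rw [← Complex.exp_add]
      congr 1
      rw [real_inner_smul_left, real_inner_comm]
      have : (ξ : ℂ) ≠ 0 := by exact_mod_cast hξ0
      push_cast
      field_simp
      ring
    rw [← h2]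
    ring
  simp_rw [hinner, integral_const_mul] at hfub
  exact (mul_eq_zero.1 hfub).resolve_left hξ

variable [CompleteSpace E]

/-- An integrable function with vanishing characteristic function vanishes. -/
theorem ae_eq_zero_of_integral_cexp_eq_zero [SigmaFinite μ] (hg : Integrable g μ)
    (h : ∀ v : E, ∫ x, Complex.exp (⟪x, v⟫ * Complex.I) * g x ∂μ = 0) : g =ᵐ[μ] 0 := by
  have hm : ∀ {k : E → ℝ}, Integrable k μ → IsFiniteMeasure (μ.withDensity fun x => .ofReal (k x)) :=
    fun hk => isFiniteMeasure_withDensity_ofReal hk.2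
  have := hm hg
  have := hm hg.neg
  have hc : ∀ {k : E → ℝ}, Integrable k μ → ∀ v,
      charFun (μ.withDensity fun x => .ofReal (k x)) v =
        ∫ x, Complex.exp (⟪x, v⟫ * Complex.I) * (max (k x) 0 : ℝ) ∂μ := by
    intro k hk v
    rw [charFun_apply, integral_withDensity_eq_integral_toReal_smul₀ hk.1.aemeasurable.ennreal_ofReal
      (ae_of_all _ fun _ => ENNReal.ofReal_lt_top)]
    refine integral_congr_ae (ae_of_all _ fun x => ?_)
    simp [ENNReal.toReal_ofReal', mul_comm]
  have hi : ∀ {k : E → ℝ}, Integrable k μ → ∀ v,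
      Integrable (fun x => Complex.exp (⟪x, v⟫ * Complex.I) * (max (k x) 0 : ℝ)) μ := by
    intro k hk v
    refine Integrable.bdd_mul (c := 1) hk.pos_part.ofReal (by fun_prop) (ae_of_all _ fun x => ?_)
    rw [Complex.norm_exp_ofReal_mul_I]
  -- The positive and negative parts of `g` define finite measures with equal characteristic
  -- functions.
  have heq : μ.withDensity (fun x => .ofReal (g x)) = μ.withDensity (fun x => .ofReal ((-g) x)) := by
    refine Measure.ext_of_charFun (funext fun v => ?_)
    rw [hc hg, hc hg.neg, ← sub_eq_zero, ← integral_sub (hi hg v) (hi hg.neg v), ← h v]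
    refine integral_congr_ae (ae_of_all _ fun x => ?_)
    simp only [← mul_sub, ← Complex.ofReal_sub, Pi.neg_apply]
    congr 2
    rcases le_total (g x) 0 with h0 | h0
    · rw [max_eq_right h0, max_eq_left (by linarith)]; ring
    · rw [max_eq_left h0, max_eq_right (by linarith)]; ring
  rw [withDensity_eq_iff_of_sigmaFinite hg.1.aemeasurable.ennreal_ofReal
    hg.neg.1.aemeasurable.ennreal_ofReal] at heq
  filter_upwards [heq] with x hx
  rcases le_total (g x) 0 with h0 | h0
  · rw [ENNReal.ofReal_of_nonpos h0, eq_comm, ENNReal.ofReal_eq_zero, Pi.neg_apply] at hx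
    exact le_antisymm h0 (neg_nonpos.1 hx)
  · rw [Pi.neg_apply, ENNReal.ofReal_of_nonpos (neg_nonpos.2 h0), ENNReal.ofReal_eq_zero] at hx
    exact le_antisymm hx h0

/-- Bounded continuous nonconstant functions are discriminatory. -/
theorem AnnihilatesRidges.ae_eq_zero [IsFiniteMeasure μ] (h : AnnihilatesRidges μ g f)
    (hg : Integrable g μ) (hf : Continuous f) (hC : ∀ t, |f t| ≤ C) (hne : ∃ s t, f s ≠ f t) :
    g =ᵐ[μ] 0 := by
  obtain ⟨η, hη, ht⟩ := exists_secondDiff_logAvg_ne_zero hf hC hne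
  have h1 := h.logAvg hg hf hC
  have h2 := h1.logAvg hg (continuous_logAvg hf) (abs_logAvg_le hC)
  have hc := continuous_logAvg (continuous_logAvg hf)
  have h3 := h2.secondDiff hg hc (abs_logAvg_le (abs_logAvg_le hC)) η
  exact ae_eq_zero_of_integral_cexp_eq_zero hg fun v =>
    h3.integral_cexp_eq_zero hg (continuous_secondDiff hc η)
      (integrable_secondDiff_logAvg hf hC hη) ht v

end Discriminatory

/-! ### Density of networks in `L_q`, by induction on depth. -/

section Density

open scoped RealInnerProductSpace

variable {ψ : ℝ → ℝ} {d : ℕ} {μ : Measure (EuclideanSpace ℝ (Fin d))}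

/-- The scalar networks of depth `m` and arbitrary width, as elements of `L_q`. -/
def scalarNetworks (ψ : ℝ → ℝ) (d m : ℕ) (q : ℝ≥0∞) (μ : Measure (EuclideanSpace ℝ (Fin d))) :
    Submodule ℝ (Lp ℝ q μ) where
  carrier := {w | ∃ n, ∃ F ∈ networkMaps ψ d n m 1, w =ᵐ[μ] fun x => F (WithLp.ofLp x) 0}
  add_mem' := by
    rintro v w ⟨n, F, hF, hv⟩ ⟨n', G, hG, hw⟩
    refine ⟨n + n', F + G, networkMaps_add hF hG, ?_⟩
    filter_upwards [Lp.coeFn_add v w, hv, hw] with x h1 h2 h3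
    rw [h1, Pi.add_apply, h2, h3]
    rfl
  zero_mem' := ⟨0, _, networkMaps_const 0 m 0, Lp.coeFn_zero _ _ _⟩
  smul_mem' := by
    rintro c v ⟨n, F, hF, hv⟩
    refine ⟨n, c • F, networkMaps_smul hF c, ?_⟩
    filter_upwards [Lp.coeFn_smul c v, hv] with x h1 h2
    rw [h1, Pi.smul_apply, h2]
    rfl

/-- The networks `ℝ^d → ℝ^d` of depth `m` and arbitrary width, as elements of `L_q`. -/
def vectorNetworks (ψ : ℝ → ℝ) (d m : ℕ) (q : ℝ≥0∞) (μ : Measure (EuclideanSpace ℝ (Fin d))) :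
    Submodule ℝ (Lp (EuclideanSpace ℝ (Fin d)) q μ) where
  carrier := {w | ∃ n, ∃ F ∈ networkMaps ψ d n m d,
    w =ᵐ[μ] fun x => WithLp.toLp 2 (F (WithLp.ofLp x))}
  add_mem' := by
    rintro v w ⟨n, F, hF, hv⟩ ⟨n', G, hG, hw⟩
    refine ⟨n + n', F + G, networkMaps_add hF hG, ?_⟩
    filter_upwards [Lp.coeFn_add v w, hv, hw] with x h1 h2 h3
    rw [h1, Pi.add_apply, h2, h3]
    rfl
  zero_mem' := ⟨0, _, networkMaps_const 0 m 0, Lp.coeFn_zero _ _ _⟩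
  smul_mem' := by
    rintro c v ⟨n, F, hF, hv⟩
    refine ⟨n, c • F, networkMaps_smul hF c, ?_⟩
    filter_upwards [Lp.coeFn_smul c v, hv] with x h1 h2
    rw [h1, Pi.smul_apply, h2]
    rfl

theorem affine_mem_scalarNetworks_zero {q : ℝ≥0∞} (a : EuclideanSpace ℝ (Fin d)) (b : ℝ)
    (h : MemLp (fun x => ⟪a, x⟫ + b) q μ) : h.toLp _ ∈ scalarNetworks ψ d 0 q μ := by
  refine ⟨0, _, ⟨Matrix.of fun _ => WithLp.ofLp a, fun _ => b, rfl⟩, ?_⟩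
  filter_upwards [h.coeFn_toLp] with x hx
  rw [hx]
  simp [Matrix.mulVec, PiLp.inner_apply, dotProduct, mul_comm]

variable [IsFiniteMeasure μ] {q : ℝ≥0∞} [Fact (1 ≤ q)]

theorem activation_affine_mem_closure {m : ℕ} {C : ℝ} {K : ℝ≥0} (hC : ∀ t, |ψ t| ≤ C)
    (hK : LipschitzWith K ψ) {a : EuclideanSpace ℝ (Fin d)} {b : ℝ}
    (h : MemLp (fun x => ⟪a, x⟫ + b) q μ)
    (hcl : h.toLp _ ∈ (scalarNetworks ψ d m q μ).topologicalClosure)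
    (h' : MemLp (fun x => ψ (⟪a, x⟫ + b)) q μ) :
    h'.toLp _ ∈ (scalarNetworks ψ d (m + 1) q μ).topologicalClosure := by
  change _ ∈ closure _ at hcl ⊢
  rw [Metric.mem_closure_iff] at hcl ⊢
  intro ε hε
  -- `K + 1` rather than `K`, as `K` may be zero.
  obtain ⟨w, ⟨n, F, hF, hw⟩, hd⟩ := hcl (ε / (K + 1)) (by positivity)
  have hFc := networkMaps_continuous hK.continuous hF
  have hψc := hK.continuous
  have hm : MemLp (fun x : EuclideanSpace ℝ (Fin d) => ψ (F (WithLp.ofLp x) 0)) q μ := by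
    refine MemLp.of_bound (Continuous.aestronglyMeasurable ?_) C (ae_of_all _ fun x => hC _)
    fun_prop
  refine ⟨hm.toLp _, ?_, ?_⟩
  -- Width `n + 1` guarantees a neuron even if `n = 0`: the scalar output is copied to all neurons
  -- and the new output layer reads neuron `0`.
  · have hpad := networkMaps_mono_width (Nat.le_succ n) m 1 hF
    have hex := networkMaps_affine hpad (Matrix.of fun (_ : Fin (n + 1)) (_ : Fin 1) => (1 : ℝ)) 0
    refine ⟨n + 1, _, ⟨_, hex, Matrix.of fun _ j => if j = 0 then 1 else 0, 0, rfl⟩, ?_⟩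
    filter_upwards [hm.coeFn_toLp] with x hx
    rw [hx]
    simp [Matrix.mulVec, dotProduct]
  · rw [dist_eq_norm] at hd ⊢
    have hle : ‖h'.toLp _ - hm.toLp _‖ ≤ K * ‖h.toLp _ - w‖ := by
      refine Lp.norm_le_mul_norm_of_ae_le_mul ?_
      filter_upwards [Lp.coeFn_sub (h'.toLp _) (hm.toLp _), Lp.coeFn_sub (h.toLp _) w,
        h'.coeFn_toLp, hm.coeFn_toLp, h.coeFn_toLp, hw] with x h1 h2 h3 h4 h5 h6
      rw [h1, h2, Pi.sub_apply, Pi.sub_apply, h3, h4, h5, h6]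
      exact hK.norm_sub_le _ _
    refine hle.trans_lt ?_
    rw [lt_div_iff₀ (by positivity)] at hd
    nlinarith [norm_nonneg (h.toLp _ - w)]

/-- Networks with at least one hidden layer are dense in `L_q`. -/
theorem scalarNetworks_closure_eq_top (hq : q ≠ ∞) (hμ : MemLp id q μ) {C : ℝ} {K : ℝ≥0}
    (hC : ∀ t, |ψ t| ≤ C) (hK : LipschitzWith K ψ) (hne : ∃ s t, ψ s ≠ ψ t) (m : ℕ) :
    (scalarNetworks ψ d (m + 1) q μ).topologicalClosure = ⊤ := by
  have haff : ∀ (a : EuclideanSpace ℝ (Fin d)) (b : ℝ), MemLp (fun x => ⟪a, x⟫ + b) q μ :=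
    fun a b => by
      have h1 : MemLp (fun x : EuclideanSpace ℝ (Fin d) => ⟪a, id x⟫) q μ := hμ.const_inner a
      exact h1.add (memLp_const b)
  have hψc := hK.continuous
  have key : ∀ m, (∀ a b, (haff a b).toLp _ ∈ (scalarNetworks ψ d m q μ).topologicalClosure) →
      (scalarNetworks ψ d (m + 1) q μ).topologicalClosure = ⊤ := by
    intro m hm
    refine eq_top_of_bounded_determining hq _ (Submodule.isClosed_topologicalClosure _)
      {f | ∃ a b, f = fun x => ψ (⟪a, x⟫ + b)} ?_ ?_
    · rintro f ⟨a, b, rfl⟩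
      refine ⟨Continuous.measurable (by fun_prop), ⟨C, fun x => hC _⟩, fun hf => ?_⟩
      exact activation_affine_mem_closure hC hK (haff a b) (hm a b) hf
    · intro g hg hann
      exact AnnihilatesRidges.ae_eq_zero (fun a b => hann _ ⟨a, b, rfl⟩) hg hψc hC hne
  induction m with
  | zero => exact key 0 fun a b =>
      Submodule.le_topologicalClosure _ (affine_mem_scalarNetworks_zero a b _)
  | succ m ih => exact key (m + 1) fun a b => ih ▸ Submodule.mem_top

/-- Each coordinate is approximated by scalar networks, and a scalar network times a basis vector is
a vector network. -/
theorem vectorNetworks_closure_eq_top (hq : q ≠ ∞) (hμ : MemLp id q μ) {C : ℝ} {K : ℝ≥0}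
    (hC : ∀ t, |ψ t| ≤ C) (hK : LipschitzWith K ψ) (hne : ∃ s t, ψ s ≠ ψ t) (m : ℕ) :
    (vectorNetworks ψ d (m + 1) q μ).topologicalClosure = ⊤ := by
  let e : Fin d → ℝ →L[ℝ] EuclideanSpace ℝ (Fin d) := fun i =>
    ContinuousLinearMap.toSpanSingleton ℝ (EuclideanSpace.single i 1)
  have hmem : ∀ (i : Fin d) (w : Lp ℝ q μ),
      (e i).compLpL q μ w ∈ (vectorNetworks ψ d (m + 1) q μ).topologicalClosure := by
    intro i
    have hle : (scalarNetworks ψ d (m + 1) q μ).topologicalClosure ≤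
        (vectorNetworks ψ d (m + 1) q μ).topologicalClosure.comap
          ((e i).compLpL q μ).toLinearMap := by
      refine Submodule.topologicalClosure_minimal _ ?_
        ((Submodule.isClosed_topologicalClosure _).preimage ((e i).compLpL q μ).continuous)
      rintro w ⟨n, F, hF, hw⟩
      refine Submodule.le_topologicalClosure _ ⟨n, _, networkMaps_affine hF
        (Matrix.of fun j _ => if j = i then 1 else 0) 0, ?_⟩
      filter_upwards [(e i).coeFn_compLpL (p := q) (μ := μ) w, hw] with x h1 h2
      refine h1.trans ?_
      rw [h2]
      ext j
      simp [e, Matrix.mulVec, dotProduct]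
    intro w
    exact hle (scalarNetworks_closure_eq_top hq hμ hC hK hne m ▸ Submodule.mem_top)
  refine eq_top_iff.2 fun θ _ => ?_
  have hsum : θ = ∑ i, (e i).compLpL q μ
      ((EuclideanSpace.proj i : EuclideanSpace ℝ (Fin d) →L[ℝ] ℝ).compLpL q μ θ) := by
    refine Lp.ext ?_
    have h1 : ∀ i, (e i).compLpL q μ
        ((EuclideanSpace.proj i : EuclideanSpace ℝ (Fin d) →L[ℝ] ℝ).compLpL q μ θ) =ᵐ[μ]
          fun x => θ x i • EuclideanSpace.single i 1 := by
      intro i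
      filter_upwards [(e i).coeFn_compLpL (p := q) (μ := μ)
        ((EuclideanSpace.proj i : EuclideanSpace ℝ (Fin d) →L[ℝ] ℝ).compLpL q μ θ),
        (EuclideanSpace.proj i : EuclideanSpace ℝ (Fin d) →L[ℝ] ℝ).coeFn_compLpL
          (p := q) (μ := μ) θ] with x h1 h2
      rw [h1, h2]
      simp [e]
    filter_upwards [Lp.coeFn_fun_finsetSum Finset.univ fun i => (e i).compLpL q μ
      ((EuclideanSpace.proj i : EuclideanSpace ℝ (Fin d) →L[ℝ] ℝ).compLpL q μ θ),
      ae_all_iff.2 h1] with x h2 h3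
    rw [h2]
    simp only [h3]
    ext j
    simp [Finset.sum_apply, Pi.single_apply]
  rw [hsum]
  exact Submodule.sum_mem _ fun i _ => hmem i _

end Density

/-! ### Continuity of the expectation in the shift. -/

section LipP

variable {X : Type*} [NormedAddCommGroup X] {p : ℝ} {f : X → ℝ}

theorem LipP.continuous (hp : 1 < p) (hf : f ∈ LipP p) : Continuous f := by
  obtain ⟨L, hL, h⟩ := hf
  refine continuous_iff_continuousAt.2 fun x => ?_
  rw [ContinuousAt, tendsto_iff_dist_tendsto_zero]
  refine squeeze_zero (fun _ => dist_nonneg) (fun y => h y x) ?_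
  have hc : Continuous fun y => L * (1 + max ‖y‖ ‖x‖) ^ (p - 1) * ‖y - x‖ := by
    refine (continuous_const.mul (Continuous.rpow_const (by fun_prop) fun y => ?_)).mul
      (by fun_prop)
    exact Or.inr (by linarith)
  have := hc.tendsto x
  rwa [sub_self, norm_zero, mul_zero] at this

variable [MeasurableSpace X] {μ : Measure X}

theorem memLp_one_add_norm [IsFiniteMeasure μ] {q : ℝ≥0∞} {u : X → X} (hu : MemLp u q μ) :
    MemLp (fun y => 1 + ‖u y‖) q μ := by
  have h1 : MemLp (fun _ : X => (1 : ℝ)) q μ := memLp_const 1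
  exact h1.add hu.norm

/-- Comparison with the origin gives the growth bound `|f x| ≤ L (1 + ‖x‖)^p + |f 0|`. -/
theorem LipP.integrable_comp [IsFiniteMeasure μ] (hp : 1 < p) (hf : f ∈ LipP p) {u : X → X}
    (hu : MemLp u (ENNReal.ofReal p) μ) : Integrable (fun y => f (u y)) μ := by
  have hc := LipP.continuous hp hf
  obtain ⟨L, hL, h⟩ := hf
  have hG : MemLp (fun y => 1 + ‖u y‖) (ENNReal.ofReal p) μ := memLp_one_add_norm hu
  have hi := hG.integrable_norm_rpow (by simp; linarith) ENNReal.ofReal_ne_top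
  rw [ENNReal.toReal_ofReal (by linarith)] at hi
  refine ((hi.const_mul L).add (integrable_const |f 0|)).mono'
    (hc.comp_aestronglyMeasurable hu.1) (ae_of_all _ fun y => ?_)
  have h1 := h (u y) 0
  rw [norm_zero, max_eq_left (norm_nonneg _), sub_zero] at h1
  have h2 : |f (u y)| ≤ |f (u y) - f 0| + |f 0| := by
    simpa using abs_add_le (f (u y) - f 0) (f 0)
  refine h2.trans (add_le_add_left (h1.trans ?_) _)
  have h0 : 0 < 1 + ‖u y‖ := by positivity
  dsimp only
  rw [mul_assoc, Real.norm_of_nonneg h0.le]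
  refine mul_le_mul_of_nonneg_left ?_ hL
  calc (1 + ‖u y‖) ^ (p - 1) * ‖u y‖ ≤ (1 + ‖u y‖) ^ (p - 1) * (1 + ‖u y‖) := by
        gcongr; linarith
    _ = (1 + ‖u y‖) ^ p := by
        rw [← Real.rpow_add_one h0.ne', sub_add_cancel]

/-- Hölder's inequality for increments of functions in `Lip_p`. -/
theorem LipP.abs_integral_sub_le [IsFiniteMeasure μ] (hp : 1 < p) {L : ℝ} (hL : 0 ≤ L)
    (h : ∀ x₁ x₂ : X, |f x₁ - f x₂| ≤ L * (1 + max ‖x₁‖ ‖x₂‖) ^ (p - 1) * ‖x₁ - x₂‖)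
    {u v : X → X} (hu : MemLp u (ENNReal.ofReal p) μ) (hv : MemLp v (ENNReal.ofReal p) μ)
    {G : X → ℝ} (hG : MemLp G (ENNReal.ofReal p) μ)
    (hGuv : ∀ᵐ y ∂μ, 1 + max ‖u y‖ ‖v y‖ ≤ G y) :
    |∫ y, f (u y) ∂μ - ∫ y, f (v y) ∂μ| ≤
      L * (eLpNorm G (ENNReal.ofReal p) μ).toReal ^ (p - 1) *
        (eLpNorm (fun y => u y - v y) (ENNReal.ofReal p) μ).toReal := by
  have hf : f ∈ LipP p := ⟨L, hL, h⟩
  have hp1 : 0 < p - 1 := by linarith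
  have hHC := (Real.HolderConjugate.conjExponent hp).symm.ennrealOfReal
  -- The conjugate exponent is `p / (p - 1)`, so the power `p - 1` brings back the `L_p` norm of
  -- `G`.
  have hGr : eLpNorm (fun y => ‖G y‖ ^ (p - 1)) (ENNReal.ofReal (Real.conjExponent p)) μ =
      eLpNorm G (ENNReal.ofReal p) μ ^ (p - 1) := by
    rw [eLpNorm_norm_rpow _ hp1, ← ENNReal.ofReal_mul (by
      rw [Real.conjExponent]; positivity), Real.conjExponent, div_mul_cancel₀ _ hp1.ne']
  rw [← integral_sub (LipP.integrable_comp hp hf hu) (LipP.integrable_comp hp hf hv)]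
  have hhol := eLpNorm_le_eLpNorm_mul_eLpNorm'_of_norm (p := ENNReal.ofReal (Real.conjExponent p))
    (q := ENNReal.ofReal p) (r := 1) (μ := μ) (f := fun y => ‖G y‖ ^ (p - 1))
    (g := fun y => ‖u y - v y‖) (hG.1.norm.aemeasurable.pow_const _).aestronglyMeasurable
    (hu.sub hv).1.norm (fun a b => L * a * b) L.toNNReal
    (ae_of_all _ fun y => by simp [abs_of_nonneg hL, hL])
  rw [hGr, eLpNorm_norm] at hhol
  have hdiff : ‖∫ y, (f (u y) - f (v y)) ∂μ‖ₑ ≤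
      L.toNNReal * eLpNorm G (ENNReal.ofReal p) μ ^ (p - 1) *
        eLpNorm (fun y => u y - v y) (ENNReal.ofReal p) μ := by
    refine (enorm_integral_le_lintegral_enorm _).trans ?_
    rw [← eLpNorm_one_eq_lintegral_enorm]
    refine (eLpNorm_mono_ae_real ?_).trans hhol
    filter_upwards [hGuv] with y hy
    refine (h _ _).trans ?_
    have : G y ≤ ‖G y‖ := le_abs_self _
    gcongr
    exact hy.trans this
  have hfin : eLpNorm G (ENNReal.ofReal p) μ ^ (p - 1) ≠ ∞ :=
    ENNReal.rpow_ne_top_of_nonneg hp1.le hG.2.ne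
  have := ENNReal.toReal_mono (ENNReal.mul_ne_top (ENNReal.mul_ne_top ENNReal.coe_ne_top hfin)
    (hu.sub hv).2.ne) hdiff
  rw [ENNReal.toReal_mul, ENNReal.toReal_mul, ← ENNReal.toReal_rpow] at this
  rwa [toReal_enorm, Real.norm_eq_abs, ENNReal.coe_toReal, Real.coe_toNNReal _ hL] at this

variable [BorelSpace X] [SecondCountableTopology X]

/-- The expectation of `f ∈ Lip_p` under the shifted law depends continuously on the shift. -/
theorem LipP.continuous_integral_shiftedLaw [IsFiniteMeasure μ] (hp : 1 < p)
    [Fact (1 ≤ ENNReal.ofReal p)] (hf : f ∈ LipP p) (hμ : MemLp id (ENNReal.ofReal p) μ) :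
    Continuous fun θ : Lp X (ENNReal.ofReal p) μ => ∫ z, f z ∂(shiftedLaw μ θ) := by
  have hc := LipP.continuous hp hf
  have hmap : ∀ θ : Lp X (ENNReal.ofReal p) μ,
      ∫ z, f z ∂(shiftedLaw μ θ) = ∫ y, f (y + θ y) ∂μ := fun θ =>
    integral_map (aemeasurable_id.add (Lp.aestronglyMeasurable θ).aemeasurable)
      hc.aestronglyMeasurable
  simp_rw [hmap]
  obtain ⟨L, hL, h⟩ := hf
  have hm : ∀ θ : Lp X (ENNReal.ofReal p) μ, MemLp (fun y => y + θ y) (ENNReal.ofReal p) μ :=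
    fun θ => MemLp.add (f := fun y => y) hμ (Lp.memLp θ)
  have hA : MemLp (fun y : X => 1 + ‖y‖) (ENNReal.ofReal p) μ := memLp_one_add_norm hμ
  set A := (eLpNorm (fun y : X => 1 + ‖y‖) (ENNReal.ofReal p) μ).toReal with hAdef
  refine continuous_iff_continuousAt.2 fun θ₀ => ?_
  rw [ContinuousAt, tendsto_iff_dist_tendsto_zero]
  have hbound : ∀ θ : Lp X (ENNReal.ofReal p) μ,
      dist (∫ y, f (y + θ y) ∂μ) (∫ y, f (y + θ₀ y) ∂μ) ≤
        L * (A + ‖θ‖ + ‖θ₀‖) ^ (p - 1) * ‖θ - θ₀‖ := by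
    intro θ
    have hθ := (Lp.memLp θ).norm
    have hθ₀ := (Lp.memLp θ₀).norm
    have hG := (hA.add hθ).add hθ₀
    refine (LipP.abs_integral_sub_le hp hL h (hm θ) (hm θ₀) hG
      (ae_of_all _ fun y => ?_)).trans ?_
    · simp only [Pi.add_apply]
      have h1 := norm_add_le y (θ y)
      have h2 := norm_add_le y (θ₀ y)
      rcases max_choice ‖y + θ y‖ ‖y + θ₀ y‖ with h3 | h3 <;> rw [h3] <;>
        linarith [norm_nonneg (θ y), norm_nonneg (θ₀ y)]
    · have hnorm : ‖θ - θ₀‖ = (eLpNorm (fun y => y + θ y - (y + θ₀ y))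
          (ENNReal.ofReal p) μ).toReal := by
        rw [Lp.norm_def]
        congr 1
        refine eLpNorm_congr_ae ?_
        filter_upwards [Lp.coeFn_sub θ θ₀] with y hy
        rw [hy, Pi.sub_apply, add_sub_add_left_eq_sub]
      rw [← hnorm]
      gcongr
      · have hone : (1 : ℝ≥0∞) ≤ ENNReal.ofReal p := Fact.out
        have h1 := (eLpNorm_add_le (hA.add hθ).1 hθ₀.1 hone).trans
          (add_le_add_left (eLpNorm_add_le hA.1 hθ.1 hone) _)
        rw [eLpNorm_norm, eLpNorm_norm] at h1
        have h2 := ENNReal.toReal_mono (ENNReal.add_ne_top.2 ⟨ENNReal.add_ne_top.2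
          ⟨hA.2.ne, (Lp.memLp θ).2.ne⟩, (Lp.memLp θ₀).2.ne⟩) h1
        rwa [ENNReal.toReal_add (ENNReal.add_ne_top.2 ⟨hA.2.ne, (Lp.memLp θ).2.ne⟩)
          (Lp.memLp θ₀).2.ne, ENNReal.toReal_add hA.2.ne (Lp.memLp θ).2.ne,
          ← Lp.norm_def, ← Lp.norm_def] at h2
  refine squeeze_zero (fun _ => dist_nonneg) hbound ?_
  have hcont : Continuous fun θ : Lp X (ENNReal.ofReal p) μ =>
      L * (A + ‖θ‖ + ‖θ₀‖) ^ (p - 1) * ‖θ - θ₀‖ := by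
    refine (continuous_const.mul (Continuous.rpow_const (by fun_prop) fun y => ?_)).mul
      (by fun_prop)
    exact Or.inr (by linarith)
  have := hcont.tendsto θ₀
  rwa [sub_self, norm_zero, mul_zero] at this

end LipP

/-! ### From density of parameters to equality of functionals. -/

section Convergence

variable {X : Type*} [NormedAddCommGroup X] [MeasurableSpace X] {p : ℝ} {μ : Measure X}
  {φ : ℝ≥0 → ℝ≥0∞} {h : ℝ≥0} {f : X → ℝ}

theorem paramFunctional_mono {Θ Θ' : Set (Lp X (ENNReal.ofReal p) μ)} (hΘ : Θ ⊆ Θ') :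
    paramFunctional p μ φ Θ h f ≤ paramFunctional p μ φ Θ' h f :=
  biSup_mono hΘ

theorem scaledPenalty_mono (hφ : Monotone φ) : Monotone (scaledPenalty φ h) := fun a b hab => by
  unfold scaledPenalty
  gcongr
  exact hφ (by gcongr)

variable [NormedSpace ℝ X]

/-- A dense parameter set containing `0` attains the full functional. -/
theorem paramFunctional_univ_le_of_dense [Fact (1 ≤ ENNReal.ofReal p)] (hφ : Monotone φ)
    (hcont : Continuous fun θ : Lp X (ENNReal.ofReal p) μ => ∫ z, f z ∂(shiftedLaw μ θ))
    {Θ : Set (Lp X (ENNReal.ofReal p) μ)} (hΘ : Dense Θ) (h0 : 0 ∈ Θ) :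
    paramFunctional p μ φ univ h f ≤ paramFunctional p μ φ Θ h f := by
  set S := paramFunctional p μ φ Θ h f with hS
  refine iSup₂_le fun θ _ => ?_
  by_cases htop : scaledPenalty φ h ‖θ‖₊ = ∞
  · simp [htop]
  have hc1 : ((scaledPenalty φ h ‖θ‖₊ : ℝ≥0∞) : EReal) ≠ ⊤ := by simpa using htop
  have hc2 : ((scaledPenalty φ h ‖θ‖₊ : ℝ≥0∞) : EReal) ≠ ⊥ := EReal.coe_ennreal_ne_bot _
  rw [EReal.sub_le_iff_le_add (Or.inl hc2) (Or.inl hc1)]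
  -- The penalty is frozen at its value for `θ`, so only the continuous expectation depends on `θ'`.
  have hclosed : IsClosed {θ' : Lp X (ENNReal.ofReal p) μ |
      ((∫ z, f z ∂(shiftedLaw μ θ') : ℝ) : EReal) ≤
        S + ((scaledPenalty φ h ‖θ‖₊ : ℝ≥0∞) : EReal)} :=
    isClosed_le (continuous_coe_real_ereal.comp hcont) continuous_const
  have hsub : Θ ∩ {θ' | ‖θ'‖₊ ≤ ‖θ‖₊} ⊆ {θ' : Lp X (ENNReal.ofReal p) μ |
      ((∫ z, f z ∂(shiftedLaw μ θ') : ℝ) : EReal) ≤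
        S + ((scaledPenalty φ h ‖θ‖₊ : ℝ≥0∞) : EReal)} := by
    rintro θ' ⟨hθ', hle⟩
    rw [mem_ofPred_eq, ← EReal.sub_le_iff_le_add (Or.inl hc2) (Or.inl hc1)]
    refine le_trans ?_ (le_iSup₂ (f := fun (θ : Lp X (ENNReal.ofReal p) μ) (_ : θ ∈ Θ) =>
      ((∫ z, f z ∂(shiftedLaw μ θ) : ℝ) : EReal) -
        ((scaledPenalty φ h ‖θ‖₊ : ℝ≥0∞) : EReal)) θ' hθ')
    exact EReal.sub_le_sub le_rfl (EReal.coe_ennreal_le_coe_ennreal_iff.2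
      (scaledPenalty_mono hφ hle))
  refine hclosed.closure_subset_iff.2 hsub ?_
  -- The open ball has closure the closed ball only for nonzero radius.
  rcases eq_or_ne θ 0 with rfl | hθ
  · exact subset_closure ⟨h0, by simp⟩
  · have hball : closure (Metric.ball (0 : Lp X (ENNReal.ofReal p) μ) ‖θ‖) ⊆
        closure (Θ ∩ {θ' | ‖θ'‖₊ ≤ ‖θ‖₊}) := by
      refine closure_minimal ?_ isClosed_closure
      refine (hΘ.open_subset_closure_inter Metric.isOpen_ball).trans (closure_mono ?_)
      rintro θ' ⟨hb, hθ'⟩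
      exact ⟨hθ', (mem_ball_zero_iff.1 hb).le⟩
    refine hball ?_
    rw [closure_ball _ (norm_ne_zero_iff.2 hθ)]
    simp

end Convergence

end ParametricRisk

theorem corollary3p3 (p : ℝ) (hp : 1 < p) (d : ℕ)
    (μ : Measure (EuclideanSpace ℝ (Fin d))) [IsProbabilityMeasure μ]
    (hμ : ParametricRisk.HasFiniteMoment p μ)
    (φ : ℝ≥0 → ℝ≥0∞) (hφ : ParametricRisk.IsPenalty φ)
    (m : ℕ) (hm : 1 ≤ m)
    (ψ : ℝ → ℝ) (hψ_bdd : ∃ C : ℝ, ∀ t, |ψ t| ≤ C) (hψ_nonconst : ∃ s t, ψ s ≠ ψ t)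
    (hψ_lip : ∃ K : ℝ≥0, LipschitzWith K ψ) :
    (∀ n : ℕ, ∀ g ∈ ParametricRisk.neuralNetworks ψ d m n, MemLp g (ENNReal.ofReal p) μ) ∧
    ∀ h : ℝ≥0, 0 < h → ∀ f ∈ ParametricRisk.LipP (X := EuclideanSpace ℝ (Fin d)) p,
      Monotone (fun n : ℕ => ParametricRisk.paramFunctional p μ φ
        (ParametricRisk.toParam p μ (ParametricRisk.neuralNetworks ψ d m n)) h f) ∧
      Tendsto (fun n : ℕ => ParametricRisk.paramFunctional p μ φ
        (ParametricRisk.toParam p μ (ParametricRisk.neuralNetworks ψ d m n)) h f) atTop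
        (𝓝 (ParametricRisk.paramFunctional p μ φ Set.univ h f)) := by
  open ParametricRisk in
  obtain ⟨K, hK⟩ := hψ_lip
  obtain ⟨m, rfl⟩ := Nat.exists_eq_add_of_le' hm
  refine ⟨fun n g hg => neuralNetworks_memLp hK.continuous hψ_bdd hg, fun h _ f hf => ?_⟩
  obtain ⟨C, hC⟩ := hψ_bdd
  have : Fact (1 ≤ ENNReal.ofReal p) := ⟨by rw [ENNReal.one_le_ofReal]; exact hp.le⟩
  have hid : MemLp id (ENNReal.ofReal p) μ := by
    refine ⟨aestronglyMeasurable_id, ?_⟩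
    rw [eLpNorm_lt_top_iff_lintegral_rpow_enorm_lt_top (by simp; linarith) ENNReal.ofReal_ne_top,
      ENNReal.toReal_ofReal (by linarith)]
    exact hμ
  have hmono : Monotone (fun n : ℕ => paramFunctional p μ φ
      (toParam p μ (neuralNetworks ψ d (m + 1) n)) h f) := fun n n' hn =>
    paramFunctional_mono fun θ ⟨g, hg, hθ⟩ => ⟨g, neuralNetworks_mono hn hg, hθ⟩
  refine ⟨hmono, ?_⟩
  have hsup : ⨆ n : ℕ, paramFunctional p μ φ
      (toParam p μ (neuralNetworks ψ d (m + 1) n)) h f = paramFunctional p μ φ univ h f := by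
    refine le_antisymm (iSup_le fun n => paramFunctional_mono (subset_univ _)) ?_
    have hdense : Dense (vectorNetworks ψ d (m + 1) (ENNReal.ofReal p) μ :
        Set (Lp (EuclideanSpace ℝ (Fin d)) (ENNReal.ofReal p) μ)) :=
      Submodule.dense_iff_topologicalClosure_eq_top.2
        (vectorNetworks_closure_eq_top ENNReal.ofReal_ne_top hid hC hK hψ_nonconst m)
    refine (paramFunctional_univ_le_of_dense hφ.monotone
      (LipP.continuous_integral_shiftedLaw hp hf hid) hdense (Submodule.zero_mem _)).trans ?_
    refine iSup₂_le fun θ hθ => ?_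
    obtain ⟨n, F, hF, hθF⟩ := hθ
    exact le_iSup_of_le n (le_iSup₂_of_le θ ⟨_, ⟨F, hF, rfl⟩, hθF⟩ le_rfl)
  rw [← hsup]
  exact tendsto_atTop_iSup hmono
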